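/- Let $(M,g)$ be a $C^\infty$-smooth, compact and connected Riemannian manifold of dimension $n \ge 2$ with nonempty boundary $\partial M$, and let $d$ be its Riemannian distance. A subset of $M$ is called a null set if it has measure zero with respect to the Riemannian volume measure. (i) Let $A \subset M$ be nonempty and compact, let $\tau : A \to \mathbb{R}$ be continuous, and define $$r(x) := \inf_{y \in A} \bigl(d(x,y) - \tau(y)\bigr), \qquad x \in M.$$ If $\tau$ is strictly positive on $A$ or $A$ is a null set, then $\{x \in M;\ r(x) = 0\}$ is a null set. (ii) Let $\Gamma \subset \partial M$ be open in $\partial M$, let $\tau : \overline{\Gamma} \to \mathbb{R}$ be continuous, and define the closed and the open domain of influence $$M(\Gamma,\tau) := \{x \in M;\ \text{there is } y \in \overline{\Gamma} \text{ such that } d(x,y) \le \tau(y)\},$$ $$M^0(\Gamma,\tau) := \{x \in M;\ \text{there is } y \in \Gamma \text{ such that } d(x,y) < \tau(y)\}.$$ Then $M^0(\Gamma,\tau) \subset M(\Gamma,\tau)$ and $M(\Gamma,\tau) \setminus M^0(\Gamma,\tau)$ is a null set. -/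

import Mathlib

open Set MeasureTheory Manifold Bundle
open scoped ContDiff ENNReal Topology

noncomputable section

section RiemannianVolume

variable {n : ℕ} {H : Type*} [TopologicalSpace H]
  (I : ModelWithCorners ℝ (EuclideanSpace ℝ (Fin n)) H)
  {M : Type*} [TopologicalSpace M] [ChartedSpace H M]

/-- The coordinate vector field `∂ᵢ` of the preferred chart `φ` at `x₀`, at the point of `M` with
coordinates `z`: the image of the `i`-th standard basis vector under the derivative of `φ⁻¹`. -/
def coordVec (x₀ : M) (z : EuclideanSpace ℝ (Fin n)) (i : Fin n) :
    TangentSpace I ((extChartAt I x₀).symm z) :=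
  mfderivWithin 𝓘(ℝ, EuclideanSpace ℝ (Fin n)) I (extChartAt I x₀).symm (range I) z
    (EuclideanSpace.single i (1 : ℝ) : EuclideanSpace ℝ (Fin n))

variable [RiemannianBundle (fun x : M => TangentSpace I x)]

/-- The matrix `(g_{jk}(z))` of the metric in the coordinates of the preferred chart at `x₀`. -/
def metricMatrix (x₀ : M) (z : EuclideanSpace ℝ (Fin n)) : Matrix (Fin n) (Fin n) ℝ :=
  Matrix.of fun j k => inner ℝ (coordVec I x₀ z j) (coordVec I x₀ z k)

/-- The measure `|g|^{1/2} dx` of the domain of the preferred chart at `x₀`, extended by zero to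
the whole of `M`. -/
def chartVolume [MeasurableSpace M] (x₀ : M) : Measure M :=
  Measure.map (extChartAt I x₀).symm
    ((volume.restrict (extChartAt I x₀).target).withDensity
      fun z => ENNReal.ofReal (Real.sqrt (metricMatrix I x₀ z).det))

variable (M) in
/-- The Riemannian volume measure. The measures `|g|^{1/2} dx` of any two charts agree on the
overlap of the charts, so that the least measure above all of them is the measure on `M` which is
`|g|^{1/2} dx` in every chart; this is proved in `riemannianVolume_apply` below. -/
def riemannianVolume [MeasurableSpace M] : Measure M :=
  ⨆ x₀ : M, chartVolume I x₀

end RiemannianVolume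

section DomainsOfInfluence

variable {M : Type*} [MetricSpace M]

/-- The function `r(x) = inf_{y ∈ A} (d(x,y) - τ(y))`. -/
def infDistSub (A : Set M) (τ : A → ℝ) (x : M) : ℝ :=
  ⨅ y : A, (dist x (y : M) - τ y)

/-- The closed domain of influence `M(Γ, τ)`. -/
def closedDomain (Γ : Set M) (τ : closure Γ → ℝ) : Set M :=
  {x | ∃ y : closure Γ, dist x (y : M) ≤ τ y}

/-- The open domain of influence `M⁰(Γ, τ)`. -/
def openDomain (Γ : Set M) (τ : closure Γ → ℝ) : Set M :=
  {x | ∃ y : closure Γ, (y : M) ∈ Γ ∧ dist x (y : M) < τ y}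

end DomainsOfInfluence

section facts

theorem measurableSet_extChartAt_target_inter {n : ℕ} {H : Type*} [TopologicalSpace H]
    (I : ModelWithCorners ℝ (EuclideanSpace ℝ (Fin n)) H)
    {M : Type*} [TopologicalSpace M] [ChartedSpace H M] [MeasurableSpace M] [BorelSpace M]
    (x₀ : M) {s : Set M} (hs : MeasurableSet s) :
    MeasurableSet ((extChartAt I x₀).target ∩ (extChartAt I x₀).symm ⁻¹' s) := by
  have hT : MeasurableSet (extChartAt I x₀).target := by
    rw [extChartAt_target]
    exact (((chartAt H x₀).open_target.preimage I.continuous_symm).measurableSet).inter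
      I.isClosed_range.measurableSet
  have h := (continuousOn_iff_continuous_domRestrict.1
    (continuousOn_extChartAt_symm (I := I) x₀)).measurable hs
  convert hT.subtype_image h using 1
  ext z
  simp [and_comm]

theorem chartVolume_apply {n : ℕ} {H : Type*} [TopologicalSpace H]
    (I : ModelWithCorners ℝ (EuclideanSpace ℝ (Fin n)) H)
    {M : Type*} [TopologicalSpace M] [ChartedSpace H M]
    [RiemannianBundle (fun x : M => TangentSpace I x)] [MeasurableSpace M] [BorelSpace M]
    (x₀ : M) {s : Set M} (hs : MeasurableSet s) :
    chartVolume I x₀ s = ∫⁻ z in (extChartAt I x₀).target ∩ (extChartAt I x₀).symm ⁻¹' s,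
      ENNReal.ofReal (Real.sqrt (metricMatrix I x₀ z).det) := by
  have hT : MeasurableSet (extChartAt I x₀).target := by
    simpa using measurableSet_extChartAt_target_inter I x₀ MeasurableSet.univ
  have hae : AEMeasurable (extChartAt I x₀).symm
      (volume.restrict (extChartAt I x₀).target) :=
    (continuousOn_extChartAt_symm x₀).aemeasurable hT
  rw [chartVolume, Measure.map_apply_of_aemeasurable
    (hae.mono_ac (withDensity_absolutelyContinuous _ _)) hs, withDensity_apply',
    Measure.restrict_restrict₀' hT.nullMeasurableSet, inter_comm]

/-- Change of coordinates for the matrix of the metric. -/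
theorem sqrt_det_metricMatrix {n : ℕ} {H : Type*} [TopologicalSpace H]
    (I : ModelWithCorners ℝ (EuclideanSpace ℝ (Fin n)) H)
    {M : Type*} [TopologicalSpace M] [ChartedSpace H M] [IsManifold I 1 M]
    [RiemannianBundle (fun x : M => TangentSpace I x)]
    (x y : M) {z : EuclideanSpace ℝ (Fin n)} (hz : z ∈ (extChartAt I x).target)
    (hy : (extChartAt I x).symm z ∈ (extChartAt I y).source) :
    Real.sqrt (metricMatrix I x z).det =
      |(fderivWithin ℝ (extChartAt I y ∘ (extChartAt I x).symm) (range I) z).det| *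
      Real.sqrt (metricMatrix I y (extChartAt I y ((extChartAt I x).symm z))).det := by
  set φ := extChartAt I x
  set ψ := extChartAt I y
  set f := ψ ∘ φ.symm
  set D := fderivWithin ℝ f (range I) z
  have hzr : z ∈ range I := extChartAt_target_subset_range x hz
  have hfz : f z ∈ ψ.target := ψ.map_source hy
  have hUD : UniqueDiffWithinAt ℝ (range I) z := I.uniqueDiffOn z hzr
  have hf : DifferentiableWithinAt ℝ f (range I) z :=
    (contDiffWithinAt_ext_coord_change (n := 1) (I := I) y x (y := z)
      ⟨hz, hy⟩).differentiableWithinAt one_ne_zero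
  have hcomp : mfderivWithin 𝓘(ℝ, EuclideanSpace ℝ (Fin n)) I (ψ.symm ∘ f) (range I) z =
      (mfderivWithin 𝓘(ℝ, EuclideanSpace ℝ (Fin n)) I ψ.symm (range I) (f z)).comp
        (mfderivWithin 𝓘(ℝ, EuclideanSpace ℝ (Fin n)) 𝓘(ℝ, EuclideanSpace ℝ (Fin n)) f
          (range I) z) :=
    mfderivWithin_comp z (mdifferentiableWithinAt_extChartAt_symm hfz)
      hf.mdifferentiableWithinAt (fun w _ => mem_range_self _) hUD.uniqueMDiffWithinAt
  have hev : ψ.symm ∘ f =ᶠ[𝓝[range I] z] φ.symm := by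
    have h1 : φ.symm ⁻¹' ψ.source ∈ 𝓝[range I] z :=
      (mdifferentiableWithinAt_extChartAt_symm hz).continuousWithinAt
        ((isOpen_extChartAt_source y).mem_nhds hy)
    filter_upwards [h1] with w hw using ψ.left_inv hw
  have hp : ψ.symm (f z) = φ.symm z := ψ.left_inv hy
  rw [hev.mfderivWithin_eq hp, mfderivWithin_eq_fderivWithin] at hcomp
  let g : ∀ p : M, EuclideanSpace ℝ (Fin n) → EuclideanSpace ℝ (Fin n) → ℝ :=
    fun p v w => @inner ℝ (TangentSpace I p) _ v w
  let Lx : EuclideanSpace ℝ (Fin n) →L[ℝ] EuclideanSpace ℝ (Fin n) :=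
    mfderivWithin 𝓘(ℝ, EuclideanSpace ℝ (Fin n)) I φ.symm (range I) z
  let Ly : EuclideanSpace ℝ (Fin n) →L[ℝ] EuclideanSpace ℝ (Fin n) :=
    mfderivWithin 𝓘(ℝ, EuclideanSpace ℝ (Fin n)) I ψ.symm (range I) (f z)
  have hL : ∀ v, Lx v = Ly (D v) := fun v => congrArg (fun T => T v) hcomp
  let e : Fin n → EuclideanSpace ℝ (Fin n) := fun i => EuclideanSpace.single i (1 : ℝ)
  have hGx : ∀ j k, metricMatrix I x z j k = g (ψ.symm (f z)) (Lx (e j)) (Lx (e k)) := by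
    intro j k
    rw [hp]
    rfl
  have hGy : ∀ j k, metricMatrix I y (f z) j k =
      g (ψ.symm (f z)) (Ly (e j)) (Ly (e k)) := fun j k => rfl
  let J : Matrix (Fin n) (Fin n) ℝ := Matrix.of fun i j => D (e j) i
  have hDe : ∀ j, D (e j) = ∑ i, J i j • e i := by
    intro j
    ext i
    simp [J, e, Finset.sum_apply, Pi.single_apply]
  have hmat : metricMatrix I x z = J.transpose * metricMatrix I y (f z) * J := by
    ext j k
    have hg : ∀ (a b : Fin n → ℝ) (u v : Fin n → EuclideanSpace ℝ (Fin n)),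
        g (ψ.symm (f z)) (∑ i, a i • u i) (∑ i, b i • v i) =
          ∑ i, ∑ l, a l * g (ψ.symm (f z)) (u l) (v i) * b i := by
      intro a b u v
      have hl : ∀ (p : M) (a : Fin n → ℝ) (u : Fin n → TangentSpace I p) (v : TangentSpace I p),
          inner ℝ (∑ i, a i • u i) v = ∑ i, a i * inner ℝ (u i) v := by
        intro p a u v
        simp [sum_inner, real_inner_smul_left]
      have hr : ∀ (p : M) (a : Fin n → ℝ) (u : Fin n → TangentSpace I p) (v : TangentSpace I p),
          inner ℝ v (∑ i, a i • u i) = ∑ i, inner ℝ v (u i) * a i := by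
        intro p a u v
        simp [inner_sum, real_inner_smul_right, mul_comm]
      refine (hr _ b v _).trans (Finset.sum_congr rfl fun i _ => ?_)
      rw [← Finset.sum_mul]
      exact congrArg (fun t => t * b i) (hl _ a u _)
    rw [hGx, hL, hL, hDe, hDe, map_sum, map_sum]
    simp only [map_smul]
    rw [hg]
    simp only [Matrix.mul_apply, Matrix.transpose_apply, Finset.sum_mul, hGy]
  have hdet : J.det = D.det := by
    have : J = LinearMap.toMatrix (EuclideanSpace.basisFun (Fin n) ℝ).toBasis
        (EuclideanSpace.basisFun (Fin n) ℝ).toBasis (D : _ →ₗ[ℝ] _) := by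
      ext i j
      simp [J, e, LinearMap.toMatrix_apply]
    rw [this, LinearMap.det_toMatrix]
  rw [hmat, Matrix.det_mul, Matrix.det_mul, Matrix.det_transpose, hdet, mul_right_comm,
    Real.sqrt_mul (mul_self_nonneg _), Real.sqrt_mul_self_eq_abs]
  rfl

theorem chartVolume_eq_of_subset {n : ℕ} {H : Type*} [TopologicalSpace H]
    (I : ModelWithCorners ℝ (EuclideanSpace ℝ (Fin n)) H)
    {M : Type*} [TopologicalSpace M] [ChartedSpace H M] [IsManifold I 1 M]
    [RiemannianBundle (fun x : M => TangentSpace I x)] [MeasurableSpace M] [BorelSpace M]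
    (x y : M) {s : Set M} (hs : MeasurableSet s) (hx : s ⊆ (extChartAt I x).source)
    (hy : s ⊆ (extChartAt I y).source) : chartVolume I x s = chartVolume I y s := by
  set φ := extChartAt I x
  set ψ := extChartAt I y
  have himg : (ψ ∘ φ.symm) '' (φ.target ∩ φ.symm ⁻¹' s) = ψ.target ∩ ψ.symm ⁻¹' s := by
    ext w
    constructor
    · rintro ⟨z, ⟨hz, hzs⟩, rfl⟩
      refine ⟨ψ.map_source (hy hzs), ?_⟩
      simpa [ψ.left_inv (hy hzs)] using hzs
    · rintro ⟨hw, hws⟩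
      refine ⟨φ (ψ.symm w), ⟨φ.map_source (hx hws), ?_⟩, ?_⟩
      · simpa [φ.left_inv (hx hws)] using hws
      · simp [φ.left_inv (hx hws), ψ.right_inv hw]
  have hinj : InjOn (ψ ∘ φ.symm) (φ.target ∩ φ.symm ⁻¹' s) := by
    intro a ha b hb hab
    exact φ.symm.injOn ha.1 hb.1 (ψ.injOn (hy ha.2) (hy hb.2) hab)
  have hder : ∀ z ∈ φ.target ∩ φ.symm ⁻¹' s, HasFDerivWithinAt (ψ ∘ φ.symm)
      (fderivWithin ℝ (ψ ∘ φ.symm) (range I) z) (φ.target ∩ φ.symm ⁻¹' s) z := by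
    intro z hz
    have h := contDiffWithinAt_ext_coord_change (n := 1) (I := I) y x (y := z)
      ⟨hz.1, hy hz.2⟩
    exact ((h.differentiableWithinAt one_ne_zero).hasFDerivWithinAt).mono
      (inter_subset_left.trans (extChartAt_target_subset_range x))
  have hms := measurableSet_extChartAt_target_inter I x hs
  rw [chartVolume_apply I x hs, chartVolume_apply I y hs, ← himg,
    lintegral_image_eq_lintegral_abs_det_fderiv_mul volume hms hder hinj]
  refine setLIntegral_congr_fun hms fun z hz => ?_
  beta_reduce
  rw [sqrt_det_metricMatrix I x y hz.1 (hy hz.2), ENNReal.ofReal_mul (abs_nonneg _)]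
  rfl

/-- The Riemannian volume measure is `|g|^{1/2} dx` in every chart. -/
theorem riemannianVolume_apply {n : ℕ} {H : Type*} [TopologicalSpace H]
    (I : ModelWithCorners ℝ (EuclideanSpace ℝ (Fin n)) H)
    {M : Type*} [TopologicalSpace M] [ChartedSpace H M] [IsManifold I 1 M]
    [RiemannianBundle (fun x : M => TangentSpace I x)] [MeasurableSpace M] [BorelSpace M]
    (x₀ : M) {s : Set M} (hs : MeasurableSet s) (hx : s ⊆ (extChartAt I x₀).source) :
    riemannianVolume I M s =
      ∫⁻ z in (extChartAt I x₀).target ∩ (extChartAt I x₀).symm ⁻¹' s,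
        ENNReal.ofReal (Real.sqrt (metricMatrix I x₀ z).det) := by
  rw [← chartVolume_apply I x₀ hs]
  refine le_antisymm ?_ (Measure.le_iff'.1 (le_iSup (chartVolume I) x₀) s)
  have hU : MeasurableSet (extChartAt I x₀).source := (isOpen_extChartAt_source x₀).measurableSet
  have key : riemannianVolume I M ≤
      chartVolume I x₀ + (⊤ : Measure M).restrict (extChartAt I x₀).sourceᶜ := by
    refine iSup_le fun y => Measure.le_iff.2 fun t ht => ?_
    have hzero : ∀ u : Set M, MeasurableSet u → chartVolume I y u =
        chartVolume I y (u ∩ (extChartAt I y).source) := by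
      intro u hu
      rw [chartVolume_apply I y hu, chartVolume_apply I y
        (hu.inter (isOpen_extChartAt_source y).measurableSet)]
      congr 2
      ext z
      simp only [mem_inter_iff, mem_preimage]
      exact ⟨fun h => ⟨h.1, h.2, (extChartAt I y).map_target h.1⟩, fun h => ⟨h.1, h.2.1⟩⟩
    rw [← measure_inter_add_sdiff t hU, Measure.add_apply, Measure.restrict_apply ht]
    refine add_le_add ?_ (Measure.le_iff'.1 le_top _)
    rw [hzero _ (ht.inter hU), chartVolume_eq_of_subset I y x₀
      ((ht.inter hU).inter (isOpen_extChartAt_source y).measurableSet)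
      inter_subset_right (inter_subset_left.trans inter_subset_right)]
    exact measure_mono (inter_subset_left.trans inter_subset_left)
  refine (Measure.le_iff'.1 key s).trans ?_
  rw [Measure.add_apply, Measure.restrict_apply hs, (disjoint_compl_right_iff_subset.2 hx).inter_eq,
    measure_empty, add_zero]

end facts

end

/-!
The function `r = infDistSub A τ` is 1-Lipschitz, and its zero set `Z` is porous. Indeed, let
`x ∈ Z`, and let the infimum be attained at `y ∈ A`, so that `d(x,y) = τ(y)`. If `y ≠ x`, which is
automatic when `τ > 0` or `x ∉ A`, then for every small `ε` an almost shortest path from `x` to `y`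
contains a point `z` with `d(x,z) = 2ε` and `d(z,y) < d(x,y) - ε`. Therefore `r(z) < -ε`, and the
ball of radius `ε` around `z` misses `Z` (`eventually_exists_disjoint_ball_infDistSub`). No
differentiability of `r` and no minimizing geodesics are needed, and boundary points of `M` play no
special role.

Porous sets are null by the Lebesgue density theorem (`measure_eq_zero_of_porous`). To apply it in
charts, one uses that charts are locally bi-Lipschitz for the Riemannian distance
(`exists_edist_extChartAt_le`, `exists_edist_extChartAt_symm_le`), and that a hole near the boundary
contains the inverse image of a Euclidean ball inside the half-space; this gives
`riemannianVolume_eq_zero_of_porous`. If `A` is null, the argument is applied to `Z \ A`.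

For the domains of influence, the difference of the closed and the open domain is contained in the
zero set of `r` for `A = closure Γ` (`closedDomain_sdiff_openDomain_subset`). This `A` is a subset of
the boundary, which is closed and null (`riemannianVolume_boundary`).
-/

/-! ### The Riemannian distance in a chart -/

section RiemannianDistance

open Metric Filter
open scoped NNReal

variable {E : Type*} [NormedAddCommGroup E] [NormedSpace ℝ E]
  {H : Type*} [TopologicalSpace H] (I : ModelWithCorners ℝ E H)
  {M : Type*} [PseudoMetricSpace M] [ChartedSpace H M]
  [RiemannianBundle (fun x : M => TangentSpace I x)]

/-- Almost geodesics: at any distance `s ≤ d(x,y)` from `x` there is a point `z` for which the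
triangle inequality `d(x,y) ≤ d(x,z) + d(z,y)` is an equality up to `η`. It lies on a path from `x`
to `y` of length less than `d(x,y) + η`. -/
theorem exists_dist_eq_and_dist_lt [IsRiemannianManifold I M] {x y : M} {s η : ℝ}
    (hs₀ : 0 ≤ s) (hs : s ≤ dist x y) (hη : 0 < η) :
    ∃ z : M, dist x z = s ∧ dist z y < dist x y - s + η := by
  have hlt : riemannianEDist I x y < ENNReal.ofReal (dist x y + η) := by
    rw [← IsRiemannianManifold.out (I := I), edist_dist]
    exact (ENNReal.ofReal_lt_ofReal_iff (by positivity)).2 (by linarith)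
  obtain ⟨γ, h0, h1, hγ, hlen⟩ := exists_lt_of_riemannianEDist_lt hlt
  have hcont : ContinuousOn (fun t => dist x (γ t)) (Icc 0 1) :=
    (continuous_const.dist continuous_id).comp_continuousOn hγ.continuousOn
  obtain ⟨t, ht, hts⟩ : s ∈ (fun t => dist x (γ t)) '' Icc 0 1 :=
    intermediate_value_Icc zero_le_one hcont (by simpa [h0, h1] using ⟨hs₀, hs⟩)
  refine ⟨γ t, hts, ?_⟩
  have e1 : edist x (γ t) ≤ pathELength I γ 0 t := by
    rw [IsRiemannianManifold.out (I := I) x (γ t)]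
    exact riemannianEDist_le_pathELength (hγ.mono (Icc_subset_Icc_right ht.2)) h0 rfl ht.1
  have e2 : edist (γ t) y ≤ pathELength I γ t 1 := by
    rw [IsRiemannianManifold.out (I := I) (γ t) y]
    exact riemannianEDist_le_pathELength (hγ.mono (Icc_subset_Icc_left ht.1)) rfl h1 ht.2
  have e3 : edist x (γ t) + edist (γ t) y < ENNReal.ofReal (dist x y + η) := by
    refine (add_le_add e1 e2).trans_lt ?_
    rwa [pathELength_add ht.1 ht.2]
  rw [edist_dist, edist_dist, ← ENNReal.ofReal_add dist_nonneg dist_nonneg,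
    ENNReal.ofReal_lt_ofReal_iff (by positivity)] at e3
  have : dist x (γ t) = s := hts
  linarith

variable [IsManifold I 1 M] [IsContinuousRiemannianBundle E (fun x : M => TangentSpace I x)]

/-- A pointwise form of `eventually_enorm_mfderivWithin_symm_extChartAt_lt`, which does not refer to
a norm on the tangent spaces of the model space `E`. -/
theorem eventually_enorm_mfderivWithin_extChartAt_symm_apply_le (x : M) :
    ∃ C > (0 : ℝ≥0), ∀ᶠ p in 𝓝[range I] (extChartAt I x x), ∀ v : E,
      ‖(mfderivWithin 𝓘(ℝ, E) I (extChartAt I x).symm (range I) p v :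
        TangentSpace I ((extChartAt I x).symm p))‖ₑ ≤ C * ‖v‖ₑ := by
  obtain ⟨C, C_pos, hC⟩ := eventually_enorm_mfderivWithin_symm_extChartAt_lt I x
  refine ⟨C, C_pos, ?_⟩
  filter_upwards [hC] with p hp v
  refine (ContinuousLinearMap.le_opENorm (E := E) (F := TangentSpace I ((extChartAt I x).symm p))
    (mfderivWithin 𝓘(ℝ, E) I (extChartAt I x).symm (range I) p) v).trans ?_
  gcongr
  exact hp.le

/-- A pointwise form of `eventually_enorm_mfderiv_extChartAt_lt`, with the norm of `E` on the
tangent spaces of the model space `E`. -/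
theorem eventually_enorm_mfderiv_extChartAt_apply_le (x : M) :
    ∃ C > (0 : ℝ≥0), ∀ᶠ y in 𝓝 x, ∀ v : TangentSpace I y,
      @enorm E _ (mfderiv I 𝓘(ℝ, E) (extChartAt I x) y v) ≤ C * ‖v‖ₑ := by
  obtain ⟨C, C_pos, hC⟩ := eventually_enorm_mfderiv_extChartAt_lt I x
  refine ⟨C, C_pos, ?_⟩
  filter_upwards [hC] with y hy v
  refine (ContinuousLinearMap.le_opENorm (E := TangentSpace I y) (F := E)
    (mfderiv I 𝓘(ℝ, E) (extChartAt I x) y) v).trans ?_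
  gcongr
  exact hy.le

variable [IsRiemannianManifold I M]

/-- The inverse of a chart is Lipschitz near the center of the chart. Both points vary, unlike in
`eventually_riemannianEDist_le_edist_extChartAt`; the path between their images is the image of a
segment, which stays in the chart because `range I` is convex. -/
theorem exists_edist_extChartAt_symm_le (x : M) :
    ∃ C > (0 : ℝ≥0), ∃ r > (0 : ℝ), ball (extChartAt I x x) r ∩ range I ⊆ (extChartAt I x).target ∧
      ∀ p ∈ ball (extChartAt I x x) r ∩ range I, ∀ q ∈ ball (extChartAt I x x) r ∩ range I,
        edist ((extChartAt I x).symm p) ((extChartAt I x).symm q) ≤ C * edist p q := by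
  obtain ⟨C, C_pos, hC⟩ := eventually_enorm_mfderivWithin_extChartAt_symm_apply_le I x
  obtain ⟨r, r_pos, hr⟩ := mem_nhdsWithin_iff.1
    (Filter.inter_mem (extChartAt_target_mem_nhdsWithin x) hC)
  refine ⟨C, C_pos, r, r_pos, hr.trans inter_subset_left, fun p hp q hq => ?_⟩
  let η := ContinuousAffineMap.lineMap (R := ℝ) p q
  set γ := (extChartAt I x).symm ∘ η
  have hη : ∀ t ∈ Icc (0 : ℝ) 1, η t ∈ ball (extChartAt I x x) r ∩ range I := by
    change Icc (0 : ℝ) 1 ⊆ η ⁻¹' _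
    rw [← image_subset_iff, ContinuousAffineMap.coe_lineMap_eq, ← segment_eq_image_lineMap]
    exact ((convex_ball _ _).inter I.convex_range).segment_subset hp hq
  have η_smooth : ContMDiffOn 𝓘(ℝ, ℝ) 𝓘(ℝ, E) 1 η (Icc 0 1) :=
    (contMDiff_iff_contDiff.2 η.contDiff).contMDiffOn
  have hlen : riemannianEDist I ((extChartAt I x).symm p) ((extChartAt I x).symm q) ≤
      pathELength I γ 0 1 := by
    apply riemannianEDist_le_pathELength _ _ _ zero_le_one
    · exact (contMDiffOn_extChartAt_symm x).comp η_smooth fun t ht => (hr (hη t ht)).1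
    · simp [γ, η, ContinuousAffineMap.coe_lineMap_eq]
    · simp [γ, η, ContinuousAffineMap.coe_lineMap_eq]
  rw [IsRiemannianManifold.out (I := I)]
  refine hlen.trans ?_
  rw [← lintegral_fderiv_lineMap_eq_edist, pathELength_eq_lintegral_mfderivWithin_Icc,
    ← lintegral_const_mul' _ _ ENNReal.coe_ne_top]
  refine setLIntegral_mono' measurableSet_Icc fun t ht => ?_
  have hcomp : mfderivWithin 𝓘(ℝ, ℝ) I γ (Icc 0 1) t =
      (mfderivWithin 𝓘(ℝ, E) I (extChartAt I x).symm (range I) (η t)).comp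
        (mfderivWithin 𝓘(ℝ, ℝ) 𝓘(ℝ, E) η (Icc 0 1) t) :=
    mfderivWithin_comp t (mdifferentiableWithinAt_extChartAt_symm (hr (hη t ht)).1)
      (η_smooth.mdifferentiableOn one_ne_zero t ht) (fun t ht => (hη t ht).2)
      (uniqueMDiffWithinAt_iff_uniqueDiffWithinAt.2 (uniqueDiffOn_Icc zero_lt_one t ht))
  rw [hcomp, mfderivWithin_eq_fderivWithin]
  exact (hr (hη t ht)).2 _

/-- A chart is Lipschitz near its center. Points of the ball of radius `ρ / 3` are at distance less
than `2ρ / 3`, so that almost shortest paths between them stay in the ball of radius `ρ`, where the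
derivative of the chart is bounded. -/
theorem exists_edist_extChartAt_le (x : M) :
    ∃ C > (0 : ℝ≥0), ∃ ρ > (0 : ℝ), ball x ρ ⊆ (extChartAt I x).source ∧
      ∀ y ∈ ball x ρ, ∀ z ∈ ball x ρ,
        edist (extChartAt I x y) (extChartAt I x z) ≤ C * edist y z := by
  obtain ⟨C, C_pos, hC⟩ := eventually_enorm_mfderiv_extChartAt_apply_le I x
  obtain ⟨ρ, hρ, hsub⟩ := Metric.mem_nhds_iff.1
    (Filter.inter_mem hC (extChartAt_source_mem_nhds (I := I) x))
  have hball : ball x (ρ / 3) ⊆ ball x ρ := ball_subset_ball (by linarith)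
  refine ⟨C, C_pos, ρ / 3, by positivity, fun y hy => (hsub (hball hy)).2,
    fun y hy z hz => ?_⟩
  rw [mem_ball] at hy hz
  have hyz : edist y z < ENNReal.ofReal (2 * ρ / 3) := by
    rw [edist_dist, ENNReal.ofReal_lt_ofReal_iff (by positivity)]
    linarith [dist_triangle_right y z x]
  have C_ne : (C : ℝ≥0∞) ≠ 0 := by exact_mod_cast C_pos.ne'
  rw [← ENNReal.div_le_iff' C_ne ENNReal.coe_ne_top]
  refine le_of_forall_gt_imp_ge_of_dense fun R hR => ?_
  rw [ENNReal.div_le_iff' C_ne ENNReal.coe_ne_top]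
  have hlt : riemannianEDist I y z < min R (ENNReal.ofReal (2 * ρ / 3)) := by
    rw [← IsRiemannianManifold.out (I := I)]
    exact lt_min hR hyz
  obtain ⟨γ, h0, h1, hγ, hlen⟩ := exists_lt_of_riemannianEDist_lt hlt
  have hmem : ∀ t ∈ Icc (0 : ℝ) 1, γ t ∈ ball x ρ := by
    intro t ht
    have h : edist y (γ t) < ENNReal.ofReal (2 * ρ / 3) := by
      rw [IsRiemannianManifold.out (I := I) y (γ t)]
      calc riemannianEDist I y (γ t) ≤ pathELength I γ 0 t :=
            riemannianEDist_le_pathELength (hγ.mono (Icc_subset_Icc_right ht.2)) h0 rfl ht.1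
        _ ≤ pathELength I γ 0 1 := pathELength_mono le_rfl ht.2
        _ < _ := hlen.trans_le (min_le_right _ _)
    rw [edist_dist, ENNReal.ofReal_lt_ofReal_iff (by positivity)] at h
    rw [mem_ball]
    linarith [dist_triangle_left (γ t) x y]
  set γ' := extChartAt I x ∘ γ
  have hγ' : ContMDiffOn 𝓘(ℝ, ℝ) 𝓘(ℝ, E) 1 γ' (Icc 0 1) :=
    contMDiffOn_extChartAt.comp (I' := I) (t := (chartAt H x).source) hγ
      fun t ht => by simpa using (hsub (hmem t ht)).2
  calc edist (extChartAt I x y) (extChartAt I x z) = ‖γ' 1 - γ' 0‖ₑ := by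
        rw [edist_comm, edist_eq_enorm_sub]
        simp [γ', h0, h1]
    _ ≤ ∫⁻ t in Icc 0 1, ‖derivWithin γ' (Icc 0 1) t‖ₑ :=
        enorm_sub_le_lintegral_derivWithin_Icc_of_contDiffOn_Icc
          (contMDiffOn_iff_contDiffOn.1 hγ') zero_le_one
    _ ≤ ∫⁻ t in Icc 0 1, C * ‖mfderivWithin 𝓘(ℝ, ℝ) I γ (Icc 0 1) t 1‖ₑ := by
        refine setLIntegral_mono' measurableSet_Icc fun t ht => ?_
        have hcomp : mfderivWithin 𝓘(ℝ, ℝ) 𝓘(ℝ, E) γ' (Icc 0 1) t =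
            (mfderiv I 𝓘(ℝ, E) (extChartAt I x) (γ t)).comp
              (mfderivWithin 𝓘(ℝ, ℝ) I γ (Icc 0 1) t) :=
          mfderiv_comp_mfderivWithin t
            (mdifferentiableAt_extChartAt (by simpa using (hsub (hmem t ht)).2))
            (hγ.mdifferentiableOn one_ne_zero t ht)
            (uniqueMDiffWithinAt_iff_uniqueDiffWithinAt.2 (uniqueDiffOn_Icc zero_lt_one t ht))
        rw [mfderivWithin_eq_fderivWithin] at hcomp
        rw [← fderivWithin_derivWithin, hcomp]
        exact (hsub (hmem t ht)).1 _
    _ = C * pathELength I γ 0 1 := by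
        rw [lintegral_const_mul' _ _ ENNReal.coe_ne_top,
          pathELength_eq_lintegral_mfderivWithin_Icc]
    _ ≤ C * R := by
        gcongr
        exact hlen.le.trans (min_le_left _ _)

end RiemannianDistance

/-! ### Porous sets and the Lebesgue density theorem -/

section Porosity

open Metric Filter

/-- A set `S` which is porous at each of its points, i.e. which misses a ball of radius `δ` at
distance at most `K δ` from the point for all small `δ`, is a null set. Otherwise it would have a
density point, near which `S` fills almost all of each of these balls. -/
theorem measure_eq_zero_of_porous {α : Type*} [PseudoMetricSpace α] [MeasurableSpace α]
    (μ : Measure α) [IsUnifLocDoublingMeasure μ] [SecondCountableTopology α] [BorelSpace α]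
    [IsLocallyFiniteMeasure μ] {S : Set α} (K : ℝ)
    (h : ∀ x ∈ S, ∀ᶠ δ in 𝓝[>] (0 : ℝ), ∃ w, dist x w ≤ K * δ ∧ Disjoint S (closedBall w δ)) :
    μ S = 0 := by
  have key := IsUnifLocDoublingMeasure.ae_tendsto_measure_inter_div μ S K
  have hfalse : ∀ᵐ x ∂μ.restrict S, x ∉ S := by
    filter_upwards [key] with x hx hxS
    -- A choice of the center for every `δ`, arbitrary where there is no empty ball.
    have hex : ∀ δ : ℝ, ∃ w : α, (∃ w', dist x w' ≤ K * δ ∧ Disjoint S (closedBall w' δ)) →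
        dist x w ≤ K * δ ∧ Disjoint S (closedBall w δ) := fun δ => by
      by_cases hδ : ∃ w', dist x w' ≤ K * δ ∧ Disjoint S (closedBall w' δ)
      · exact ⟨hδ.choose, fun _ => hδ.choose_spec⟩
      · exact ⟨x, fun h' => absurd h' hδ⟩
    choose w hw using hex
    have hlim := hx w id tendsto_id ((h x hxS).mono fun δ hδ => (hw δ hδ).1)
    have hzero : (fun δ => μ (S ∩ closedBall (w δ) (id δ)) / μ (closedBall (w δ) (id δ)))
        =ᶠ[𝓝[>] (0 : ℝ)] fun _ => 0 := by
      filter_upwards [h x hxS] with δ hδ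
      rw [id, (hw δ hδ).2.inter_eq, measure_empty, ENNReal.zero_div]
    exact zero_ne_one (tendsto_nhds_unique (tendsto_const_nhds.congr' hzero.symm) hlim)
  rw [ae_iff] at hfalse
  simp only [not_not, ofPred_mem_eq] at hfalse
  rwa [Measure.restrict_apply_self] at hfalse

end Porosity

/-! ### Null sets of the Riemannian volume -/

section NullSets

open Metric Filter
open scoped NNReal

/-- The Riemannian volume is given by a density in each chart, so a set whose image in a chart at
each point is Lebesgue null near the point is a null set. -/
theorem riemannianVolume_eq_zero_of_locally {n : ℕ} {H : Type*} [TopologicalSpace H]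
    (I : ModelWithCorners ℝ (EuclideanSpace ℝ (Fin n)) H)
    {M : Type*} [TopologicalSpace M] [SecondCountableTopology M] [ChartedSpace H M]
    [IsManifold I 1 M] [RiemannianBundle (fun x : M => TangentSpace I x)]
    [MeasurableSpace M] [BorelSpace M] {S : Set M} (hS : MeasurableSet S)
    (h : ∀ x : M, ∃ W ∈ 𝓝 x,
      volume ((extChartAt I x).target ∩ (extChartAt I x).symm ⁻¹' (S ∩ W)) = 0) :
    riemannianVolume I M S = 0 := by
  refine measure_null_of_locally_null S fun x _ => ?_
  obtain ⟨W, hW, h0⟩ := h x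
  have hmem : interior W ∩ (extChartAt I x).source ∈ 𝓝 x :=
    Filter.inter_mem (interior_mem_nhds.2 hW) (extChartAt_source_mem_nhds x)
  refine ⟨S ∩ (interior W ∩ (extChartAt I x).source), inter_mem_nhdsWithin S hmem, ?_⟩
  rw [riemannianVolume_apply I x
    (hS.inter (isOpen_interior.inter (isOpen_extChartAt_source x)).measurableSet)
    (inter_subset_right.trans inter_subset_right)]
  refine setLIntegral_measure_zero _ _ (measure_mono_null ?_ h0)
  exact inter_subset_inter_right _ (preimage_mono
    (inter_subset_inter_right _ (inter_subset_left.trans interior_subset)))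

/-- By the invariance of the boundary under changes of charts, the boundary is contained in the
frontier of a convex set in every chart. -/
theorem riemannianVolume_boundary {n : ℕ} {H : Type*} [TopologicalSpace H]
    (I : ModelWithCorners ℝ (EuclideanSpace ℝ (Fin n)) H)
    {M : Type*} [TopologicalSpace M] [SecondCountableTopology M] [ChartedSpace H M]
    [IsManifold I 1 M] [RiemannianBundle (fun x : M => TangentSpace I x)]
    [MeasurableSpace M] [BorelSpace M] :
    riemannianVolume I M (I.boundary M) = 0 := by
  refine riemannianVolume_eq_zero_of_locally I
    (I.isClosed_boundary (M := M) one_ne_zero).measurableSet fun x => ⟨univ, univ_mem, ?_⟩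
  refine measure_mono_null ?_ (I.convex_range.addHaar_frontier volume)
  rintro z ⟨hz, hzb, -⟩
  have hsrc : (extChartAt I x).symm z ∈ (chartAt H x).source := by
    simpa using (extChartAt I x).map_target hz
  have hfr := (I.isBoundaryPoint_iff_of_mem_atlas one_ne_zero (chart_mem_atlas H x) hsrc).1 hzb
  have hzfr : z ∈ frontier (extChartAt I x).target := by
    rw [← (extChartAt I x).right_inv hz]
    exact hfr
  refine ⟨subset_closure (extChartAt_target_subset_range x hz), fun hint => hzfr.2 ?_⟩
  rw [mem_interior_iff_mem_nhds] at hint ⊢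
  have := extChartAt_target_mem_nhdsWithin_of_mem hz
  rwa [nhdsWithin_eq_nhds.2 hint] at this

/-- A point of the half-space, moved by `δ` in the inward direction, is the center of a full
Euclidean ball of radius `δ` contained in the half-space. -/
theorem closedBall_add_single_subset_range {n : ℕ} [NeZero n] {p : EuclideanSpace ℝ (Fin n)}
    (hp : p ∈ range (𝓡∂ n)) (δ : ℝ) :
    closedBall (p + EuclideanSpace.single 0 δ) δ ⊆ range (𝓡∂ n) := by
  rw [range_modelWithCornersEuclideanHalfSpace] at hp ⊢
  intro q hq
  have h1 := (PiLp.norm_apply_le (q - (p + EuclideanSpace.single 0 δ)) 0).trans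
    (mem_closedBall_iff_norm.1 hq)
  have hp : 0 ≤ p 0 := hp
  simp only [PiLp.sub_apply, PiLp.add_apply, PiLp.single_apply, if_true,
    Real.norm_eq_abs] at h1
  have := (abs_le.1 h1).1
  change 0 ≤ q 0
  linarith

/-- Sets which are porous for the Riemannian distance are null for the Riemannian volume: the
charts are locally bi-Lipschitz, so that the image of the set in a chart is porous too. This
includes points at the boundary, where the hole in the chart is moved into the half-space. -/
theorem riemannianVolume_eq_zero_of_porous {n : ℕ} [NeZero n]
    {M : Type*} [MetricSpace M] [SecondCountableTopology M]
    [ChartedSpace (EuclideanHalfSpace n) M] [IsManifold (𝓡∂ n) 1 M]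
    [RiemannianBundle (fun x : M => TangentSpace (𝓡∂ n) x)]
    [IsContinuousRiemannianBundle (EuclideanSpace ℝ (Fin n))
      (fun x : M => TangentSpace (𝓡∂ n) x)]
    [IsRiemannianManifold (𝓡∂ n) M] [MeasurableSpace M] [BorelSpace M]
    {S : Set M} (hS : MeasurableSet S) (K : ℝ)
    (h : ∀ x ∈ S, ∀ᶠ ε in 𝓝[>] (0 : ℝ), ∃ z, dist x z ≤ K * ε ∧ Disjoint S (ball z ε)) :
    riemannianVolume (𝓡∂ n) M S = 0 := by
  refine riemannianVolume_eq_zero_of_locally _ hS fun x₀ => ?_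
  obtain ⟨A, hA, r, hr, -, hsymm⟩ := exists_edist_extChartAt_symm_le (𝓡∂ n) x₀
  obtain ⟨B, hB, ρ, hρ, hsrc, hchart⟩ := exists_edist_extChartAt_le (𝓡∂ n) x₀
  set φ := extChartAt (𝓡∂ n) x₀
  have hB' : (0 : ℝ) < B := hB
  have hA' : (0 : ℝ) < A := hA
  have hchart' : ∀ y ∈ ball x₀ ρ, ∀ z ∈ ball x₀ ρ, dist (φ y) (φ z) ≤ B * dist y z := by
    intro y hy z hz
    have := hchart y hy z hz
    rwa [edist_nndist, edist_nndist, ← ENNReal.coe_mul, ENNReal.coe_le_coe,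
      ← NNReal.coe_le_coe] at this
  have hsymm' : ∀ p ∈ ball (φ x₀) r ∩ range (𝓡∂ n), ∀ q ∈ ball (φ x₀) r ∩ range (𝓡∂ n),
      dist (φ.symm p) (φ.symm q) ≤ A * dist p q := by
    intro y hy z hz
    have := hsymm y hy z hz
    rwa [edist_nndist, edist_nndist, ← ENNReal.coe_mul, ENNReal.coe_le_coe,
      ← NNReal.coe_le_coe] at this
  -- The chart maps the `ρ'`-ball into the `r / 2`-ball, which leaves room for the moved hole.
  set ρ' := min ρ (r / (2 * B))
  have hρ' : 0 < ρ' := by positivity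
  refine ⟨ball x₀ (ρ' / 2), ball_mem_nhds _ (by positivity), ?_⟩
  refine measure_eq_zero_of_porous volume (1 + B * (K * (4 * A))) fun z hz => ?_
  obtain ⟨hzt, hzS, hzW⟩ := hz
  -- The scale `ε = 4 A δ` makes the inverse chart map `2 δ`-balls into `ε`-balls.
  have hlim : Tendsto (fun δ : ℝ => 4 * A * δ) (𝓝[>] 0) (𝓝[>] 0) := by
    refine tendsto_nhdsWithin_iff.2 ⟨?_, ?_⟩
    · have : Tendsto (fun δ : ℝ => 4 * A * δ) (𝓝 0) (𝓝 (4 * A * 0)) := by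
        exact (continuous_const.mul continuous_id).tendsto 0
      rw [mul_zero] at this
      exact this.mono_left nhdsWithin_le_nhds
    · filter_upwards [self_mem_nhdsWithin] with δ (hδ : 0 < δ)
      exact mem_Ioi.2 (by positivity)
  have hsmall : ∀ a : ℝ, 0 < a → ∀ c : ℝ, ∀ᶠ δ in 𝓝[>] (0 : ℝ), c * δ < a := by
    intro a ha c
    have : Tendsto (fun δ : ℝ => c * δ) (𝓝 0) (𝓝 (c * 0)) :=
      (continuous_const.mul continuous_id).tendsto 0
    rw [mul_zero] at this
    exact (this.mono_left nhdsWithin_le_nhds).eventually_lt_const ha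
  filter_upwards [hlim.eventually (h _ hzS), self_mem_nhdsWithin, hsmall (r / 2) (by positivity) 2,
    hsmall (ρ' / 2) (by positivity) (K * (4 * A))] with δ hδ (hδ0 : 0 < δ) hδr hδρ
  obtain ⟨y, hdy, hdisj⟩ := hδ
  have hxy : dist (φ.symm z) y ≤ K * (4 * A) * δ := by linarith
  rw [mem_ball] at hzW
  have hy' : dist y x₀ < ρ' := by
    linarith [dist_triangle_left y x₀ (φ.symm z)]
  have hyρ : y ∈ ball x₀ ρ := mem_ball.2 (hy'.trans_le (min_le_left _ _))
  have hzρ : φ.symm z ∈ ball x₀ ρ :=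
    mem_ball.2 (by linarith [min_le_left ρ (r / (2 * B))])
  have hyr : dist (φ y) (φ x₀) < r / 2 := by
    have h1 := hchart' y hyρ x₀ (mem_ball_self hρ)
    have h2 : dist y x₀ < r / (2 * B) := hy'.trans_le (min_le_right _ _)
    rw [lt_div_iff₀ (by positivity)] at h2
    linarith
  have hyrange : φ y ∈ range (𝓡∂ n) :=
    extChartAt_target_subset_range x₀ (φ.map_source (hsrc hyρ))
  have hsingle : ‖(EuclideanSpace.single 0 δ : EuclideanSpace ℝ (Fin n))‖ = δ := by
    rw [PiLp.norm_single, Real.norm_of_nonneg hδ0.le]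
  refine ⟨φ y + EuclideanSpace.single 0 δ, ?_, ?_⟩
  · have h1 : dist z (φ y) ≤ B * (K * (4 * A) * δ) := by
      have := hchart' _ hzρ y hyρ
      rw [φ.right_inv hzt] at this
      exact this.trans (by gcongr)
    have h2 : dist (φ y) (φ y + EuclideanSpace.single 0 δ) = δ := by
      rw [dist_self_add_right, hsingle]
    linarith [dist_triangle z (φ y) (φ y + EuclideanSpace.single 0 δ)]
  · rw [Set.disjoint_left]
    rintro u ⟨-, huS, -⟩ hu
    refine Set.disjoint_left.1 hdisj huS ?_
    have hur := closedBall_add_single_subset_range hyrange δ hu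
    have huy : dist u (φ y) ≤ 2 * δ := by
      have := dist_triangle u (φ y + EuclideanSpace.single 0 δ) (φ y)
      rw [dist_self_add_left, hsingle] at this
      linarith [mem_closedBall.1 hu]
    have hub : u ∈ ball (φ x₀) r := by
      rw [mem_ball]
      linarith [dist_triangle u (φ y) (φ x₀)]
    have := hsymm' u ⟨hub, hur⟩ (φ y) ⟨mem_ball.2 (by linarith), hyrange⟩
    rw [φ.left_inv (hsrc hyρ)] at this
    rw [mem_ball]
    -- `d(φ⁻¹ u, y) ≤ A * (2 δ) < 4 A δ = ε`
    nlinarith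

end NullSets

/-! ### The function `infDistSub` and its zero set -/

section InfDistSub

open Metric Filter

variable {M : Type*} [MetricSpace M] {A : Set M} {τ : A → ℝ}

theorem exists_infDistSub_eq (hA : IsCompact A) (hne : A.Nonempty) (hτ : Continuous τ) (x : M) :
    ∃ y : A, infDistSub A τ x = dist x (y : M) - τ y ∧
      ∀ z : A, infDistSub A τ x ≤ dist x (z : M) - τ z := by
  have : CompactSpace A := isCompact_iff_compactSpace.1 hA
  have : Nonempty A := hne.to_subtype
  have hcont : Continuous fun y : A => dist x (y : M) - τ y := by fun_prop
  obtain ⟨y, -, hy⟩ := isCompact_univ.exists_isMinOn univ_nonempty hcont.continuousOn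
  have hmin : ∀ z : A, dist x (y : M) - τ y ≤ dist x (z : M) - τ z := fun z => hy (mem_univ z)
  have hle : ∀ z : A, infDistSub A τ x ≤ dist x (z : M) - τ z :=
    ciInf_le ⟨_, forall_mem_range.2 hmin⟩
  exact ⟨y, (hle y).antisymm (le_ciInf hmin), hle⟩

theorem infDistSub_le_add (hA : IsCompact A) (hne : A.Nonempty) (hτ : Continuous τ) (x y : M) :
    infDistSub A τ x ≤ infDistSub A τ y + dist x y := by
  obtain ⟨z, hz, -⟩ := exists_infDistSub_eq hA hne hτ y
  obtain ⟨-, -, hx⟩ := exists_infDistSub_eq hA hne hτ x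
  linarith [hx z, dist_triangle x y z]

theorem continuous_infDistSub (hA : IsCompact A) (hne : A.Nonempty) (hτ : Continuous τ) :
    Continuous (infDistSub A τ) :=
  (LipschitzWith.of_le_add (infDistSub_le_add hA hne hτ)).continuous

/-- The zero set of `r = infDistSub A τ` is porous at each of its points `x` whose minimizer
`y ∈ A`, i.e. the one with `r(x) = d(x,y) - τ(y)`, is different from `x`: a step of length `2ε`
from `x` along an almost shortest path to `y` leads to a point where `r < -ε`, and `r` is
1-Lipschitz. The hypothesis `hpos` excludes `y = x`, as `r(x) = 0` would give `τ(x) = 0`. -/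
theorem eventually_exists_disjoint_ball_infDistSub {E : Type*} [NormedAddCommGroup E]
    [NormedSpace ℝ E] {H : Type*} [TopologicalSpace H] (I : ModelWithCorners ℝ E H)
    [ChartedSpace H M] [RiemannianBundle (fun x : M => TangentSpace I x)]
    [IsRiemannianManifold I M]
    (hA : IsCompact A) (hne : A.Nonempty) (hτ : Continuous τ) {x : M}
    (hx : infDistSub A τ x = 0) (hpos : ∀ y : A, (y : M) = x → 0 < τ y) :
    ∀ᶠ ε in 𝓝[>] (0 : ℝ), ∃ z, dist x z ≤ 2 * ε ∧
      Disjoint {w | infDistSub A τ w = 0} (ball z ε) := by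
  obtain ⟨y, hy, -⟩ := exists_infDistSub_eq hA hne hτ x
  have hd : 0 < dist x (y : M) := by
    refine dist_pos.2 fun hxy => ?_
    have := hpos y hxy.symm
    rw [hxy, dist_self, ← hxy, hx] at hy
    linarith
  filter_upwards [Ioo_mem_nhdsGT (half_pos hd)] with ε hε
  obtain ⟨z, hxz, hzy⟩ := exists_dist_eq_and_dist_lt I (s := 2 * ε) (by linarith [hε.1])
    (by linarith [hε.2]) hε.1
  refine ⟨z, hxz.le, Set.disjoint_left.2 fun w hw hwz => ?_⟩
  obtain ⟨-, -, hle⟩ := exists_infDistSub_eq hA hne hτ w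
  have hw : infDistSub A τ w = 0 := hw
  linarith [hle y, dist_triangle w z (y : M), mem_ball.1 hwz]

/-- A point `x` of the closed domain satisfies `r(x) ≤ 0`. If it is not in the open domain, then
`d(x,y) - τ(y) ≥ 0` for `y ∈ Γ`, hence for `y ∈ closure Γ`, so that `r(x) ≥ 0`. -/
theorem closedDomain_sdiff_openDomain_subset {Γ : Set M} {τ : closure Γ → ℝ}
    (hΓ : IsCompact (closure Γ)) (hne : (closure Γ).Nonempty) (hτ : Continuous τ) :
    closedDomain Γ τ \ openDomain Γ τ ⊆ {x | infDistSub (closure Γ) τ x = 0} := by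
  rintro x ⟨⟨y, hy⟩, hx⟩
  obtain ⟨z, hz, hle⟩ := exists_infDistSub_eq hΓ hne hτ x
  refine le_antisymm ((hle y).trans (sub_nonpos.2 hy)) ?_
  rw [hz]
  refine ((denseRange_inclusion_iff subset_closure).2 le_rfl).induction_on
    (p := fun z : closure Γ => 0 ≤ dist x (z : M) - τ z) z ?_ fun y => ?_
  · exact isClosed_le continuous_const (by fun_prop)
  · exact sub_nonneg.2 (not_lt.1 fun hlt => hx ⟨inclusion subset_closure y, y.2, hlt⟩)

theorem openDomain_subset_closedDomain (Γ : Set M) (τ : closure Γ → ℝ) :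
    openDomain Γ τ ⊆ closedDomain Γ τ :=
  fun _ ⟨y, _, hy⟩ => ⟨y, hy.le⟩

end InfDistSub

/-! ### The null sets -/

theorem riemannianVolume_setOf_infDistSub_eq_zero {n : ℕ} [NeZero n]
    {M : Type*} [MetricSpace M] [SecondCountableTopology M]
    [ChartedSpace (EuclideanHalfSpace n) M] [IsManifold (𝓡∂ n) 1 M]
    [RiemannianBundle (fun x : M => TangentSpace (𝓡∂ n) x)]
    [IsContinuousRiemannianBundle (EuclideanSpace ℝ (Fin n))
      (fun x : M => TangentSpace (𝓡∂ n) x)]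
    [IsRiemannianManifold (𝓡∂ n) M] [MeasurableSpace M] [BorelSpace M]
    {A : Set M} {τ : A → ℝ} (hA : IsCompact A) (hne : A.Nonempty) (hτ : Continuous τ)
    (h : (∀ y, 0 < τ y) ∨ riemannianVolume (𝓡∂ n) M A = 0) :
    riemannianVolume (𝓡∂ n) M {x : M | infDistSub A τ x = 0} = 0 := by
  have hZ : MeasurableSet {x : M | infDistSub A τ x = 0} :=
    (isClosed_singleton.preimage (continuous_infDistSub hA hne hτ)).measurableSet
  rcases h with hpos | hnull
  · exact riemannianVolume_eq_zero_of_porous hZ 2 fun x hx =>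
      eventually_exists_disjoint_ball_infDistSub (𝓡∂ n) hA hne hτ hx fun y _ => hpos y
  -- A zero of `r` in `A` may be its own minimizer `y`, but `A` is null.
  · have hdiff : riemannianVolume (𝓡∂ n) M ({x : M | infDistSub A τ x = 0} \ A) = 0 := by
      refine riemannianVolume_eq_zero_of_porous (hZ.diff hA.measurableSet) 2 fun x hx => ?_
      filter_upwards [eventually_exists_disjoint_ball_infDistSub (𝓡∂ n) hA hne hτ hx.1
        fun y hy => absurd (hy ▸ y.2) hx.2] with ε ⟨z, hz, hdisj⟩
      exact ⟨z, hz, hdisj.mono_left sdiff_subset⟩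
    refine measure_mono_null (fun x hx => ?_) (measure_union_null hdiff hnull)
    by_cases hxA : x ∈ A
    · exact Or.inr hxA
    · exact Or.inl ⟨hx, hxA⟩

theorem lemma4p2 {n : ℕ} [NeZero n] (hn : 2 ≤ n)
    {M : Type*} [MetricSpace M] [CompactSpace M] [ConnectedSpace M]
    [ChartedSpace (EuclideanHalfSpace n) M] [IsManifold (𝓡∂ n) ∞ M]
    [RiemannianBundle (fun x : M => TangentSpace (𝓡∂ n) x)]
    [IsContMDiffRiemannianBundle (𝓡∂ n) ∞ (EuclideanSpace ℝ (Fin n))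
      (fun x : M => TangentSpace (𝓡∂ n) x)]
    [IsRiemannianManifold (𝓡∂ n) M]
    [MeasurableSpace M] [BorelSpace M]
    (hM : ((𝓡∂ n).boundary M).Nonempty) :
    (∀ (A : Set M) (τ : A → ℝ), IsCompact A → A.Nonempty → Continuous τ →
      ((∀ y, 0 < τ y) ∨ riemannianVolume (𝓡∂ n) M A = 0) →
      riemannianVolume (𝓡∂ n) M {x : M | infDistSub A τ x = 0} = 0) ∧
    (∀ (Γ : Set M) (τ : closure Γ → ℝ),
      (∃ U : Set M, IsOpen U ∧ Γ = U ∩ (𝓡∂ n).boundary M) → Continuous τ →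
      openDomain Γ τ ⊆ closedDomain Γ τ ∧
      riemannianVolume (𝓡∂ n) M (closedDomain Γ τ \ openDomain Γ τ) = 0) := by
  have : IsManifold (𝓡∂ n) 1 M := IsManifold.of_le (n := ∞) (mod_cast le_top)
  have : IsContinuousRiemannianBundle (EuclideanSpace ℝ (Fin n))
      (fun x : M => TangentSpace (𝓡∂ n) x) := by
    obtain ⟨g, hg, hgg⟩ := ‹IsContMDiffRiemannianBundle (𝓡∂ n) ∞ (EuclideanSpace ℝ (Fin n))
      (fun x : M => TangentSpace (𝓡∂ n) x)›
    exact ⟨g, hg.continuous, hgg⟩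
  refine ⟨fun A τ hA hne hτ h => riemannianVolume_setOf_infDistSub_eq_zero hA hne hτ h,
    fun Γ τ hΓ hτ => ⟨openDomain_subset_closedDomain Γ τ, ?_⟩⟩
  obtain ⟨U, -, rfl⟩ := hΓ
  rcases (closure (U ∩ (𝓡∂ n).boundary M)).eq_empty_or_nonempty with hempty | hne
  · refine measure_mono_null (t := ∅) ?_ measure_empty
    rintro x ⟨⟨y, -⟩, -⟩
    exact (hempty ▸ y.2 : (y : M) ∈ (∅ : Set M))
  · refine measure_mono_null
      (closedDomain_sdiff_openDomain_subset isClosed_closure.isCompact hne hτ)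
      (riemannianVolume_setOf_infDistSub_eq_zero isClosed_closure.isCompact hne hτ (Or.inr ?_))
    refine measure_mono_null ?_ (riemannianVolume_boundary (𝓡∂ n) (M := M))
    exact closure_minimal inter_subset_right ((𝓡∂ n).isClosed_boundary (M := M) one_ne_zero)
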